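/- Let $(M^2,g)$ be a non-empty oriented $C^\infty$ Riemannian 2-manifold with unit area element $\Omega_g$ and Levi-Civita connection $\nabla$; write $[v,w]:=\Omega_g(v,w)$ and $|v|:=\sqrt{g(v,v)}$. For a $C^\infty$ curve $\gamma:(-\delta,\delta)\to M^2$ ($\delta>0$) put $\ddot\gamma:=\nabla_t\dot\gamma$ and $\gamma^{(3)}:=\nabla_t\ddot\gamma$. The curve has a $3/2$-cusp at $t=0$ if $\dot\gamma(0)=0$ and $[\ddot\gamma(0),\gamma^{(3)}(0)]\neq 0$. Let $s_g(t):=\int_0^t|\dot\gamma(u)|\,du$ be the arclength parameter, and let $$\kappa_g(t):=\frac{[\dot\gamma(t),\ddot\gamma(t)]}{|\dot\gamma(t)|^3}$$ be the geodesic curvature, defined where $\dot\gamma(t)\ne 0$. Let $C_0^\infty(\mathbf R)$ be the set of germs at $t=0$ of real-valued $C^\infty$ functions defined near $t=0$, and let $S_0^*(\mathbf R,M^2)$ be the set of germs at $t=0$ of $C^\infty$ curves in $M^2$ with a $3/2$-cusp at $t=0$. For $\gamma\in S_0^*(\mathbf R,M^2)$ let $\mathcal F_g(\gamma)$ be the germ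 at $t=0$ of the normalized curvature function $\sqrt{|s_g(t)|}\,\kappa_g(t)$, whose value at the singular point $t=0$ is its limit as $t\to0$. Then $\mathcal F_g$ is a well-defined map $S_0^*(\mathbf R,M^2)\to C_0^\infty(\mathbf R)$, and its image is exactly $$\Sigma_g:=\{f\in C_0^\infty(\mathbf R)\;:\;f(0)\neq 0\}.$$ -/

import Mathlib

open Filter Topology Manifold Bundle
open scoped ContDiff

namespace CuspCurvature

noncomputable section

/-- The coordinate plane on which 2-manifolds are modelled. -/
abbrev Plane : Type := EuclideanSpace ℝ (Fin 2)

section Oriented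

variable (M : Type*) [TopologicalSpace M] [ChartedSpace Plane M] [IsManifold (𝓡 2) ∞ M]

/-- An orientation of a 2-manifold: an orientation of every tangent plane which, read in the
coordinates of a chart, is locally constant. -/
structure ManifoldOrientation where
  /-- the orientation of the tangent plane at `x` -/
  orient : ∀ x : M, Orientation ℝ (TangentSpace (𝓡 2) x) (Fin 2)
  locally_constant : ∀ c : M, ∃ o₀ : Orientation ℝ Plane (Fin 2), ∀ᶠ x in 𝓝 c,
    ∀ hx : x ∈ (trivializationAt Plane (TangentSpace (𝓡 2) : M → Type _) c).baseSet,
      Orientation.map (Fin 2)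
        ((trivializationAt Plane (TangentSpace (𝓡 2) : M → Type _) c).continuousLinearEquivAt
          ℝ x hx).toLinearEquiv (orient x) = o₀

end Oriented

variable {M : Type*} [TopologicalSpace M] [ChartedSpace Plane M] [IsManifold (𝓡 2) ∞ M]

instance tangentPlane_finrank (x : M) :
    Fact (Module.finrank ℝ (TangentSpace (𝓡 2) x) = 2) :=
  ⟨(finrank_euclideanSpace_fin : Module.finrank ℝ (EuclideanSpace ℝ (Fin 2)) = 2)⟩

/-- The coordinates, in the preferred chart `φ` around `c`, of a tangent vector `v` at `x`
(`x` in the domain of the chart). This is the derivative of `φ` at `x`, applied to `v`. -/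
def toCoord (c x : M) (v : TangentSpace (𝓡 2) x) : Plane :=
  (trivializationAt Plane (TangentSpace (𝓡 2) : M → Type _) c).continuousLinearMapAt ℝ x v

/-- The tangent vector at `x` with given coordinates in the preferred chart around `c`
(`x` in the domain of the chart); inverse to `toCoord c x`. -/
def ofCoord (c x : M) (v : Plane) : TangentSpace (𝓡 2) x :=
  (trivializationAt Plane (TangentSpace (𝓡 2) : M → Type _) c).symmL ℝ x v

/-- The standard basis vectors of the coordinate plane. -/
def basisVec (i : Fin 2) : Plane := EuclideanSpace.single i (1 : ℝ)

/-- The velocity vector of a curve. -/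
def velocity (γ : ℝ → M) (t : ℝ) : TangentSpace (𝓡 2) (γ t) :=
  mfderiv 𝓘(ℝ, ℝ) (𝓡 2) γ t (1 : ℝ)

variable [RiemannianBundle (fun x : M => TangentSpace (𝓡 2) x)]

/-- The matrix `(g_ij)` of the metric in the chart around `c`, as a function of the coordinates. -/
def metricMatrix (c : M) (y : Plane) : Matrix (Fin 2) (Fin 2) ℝ :=
  Matrix.of fun i j =>
    inner ℝ (ofCoord c ((extChartAt (𝓡 2) c).symm y) (basisVec i))
      (ofCoord c ((extChartAt (𝓡 2) c).symm y) (basisVec j))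

/-- The partial derivative `∂_k g_ij` in the chart around `c`. -/
def metricDeriv (c : M) (y : Plane) (k i j : Fin 2) : ℝ :=
  fderiv ℝ (fun z => metricMatrix c z i j) y (basisVec k)

/-- The Christoffel symbol `Γ^k_ij` of the Levi-Civita connection in the chart around `c`. -/
def christoffel (c : M) (y : Plane) (k i j : Fin 2) : ℝ :=
  (1 / 2) * ∑ l, (metricMatrix c y)⁻¹ k l *
    (metricDeriv c y i j l + metricDeriv c y j i l - metricDeriv c y l i j)

/-- The Levi-Civita covariant derivative `∇_t X` of a vector field `X` along a curve `γ`, computed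
in the chart around `c`:
`(∇_t X)^k = dX^k/dt + ∑ i j, Γ^k_ij(γ) (dγ/dt)^i X^j`.
As long as `γ` stays in the domain of the chart, the result does not depend on `c`. -/
def covDerivAlong (c : M) (γ : ℝ → M) (X : ∀ t, TangentSpace (𝓡 2) (γ t)) (t : ℝ) :
    TangentSpace (𝓡 2) (γ t) :=
  ofCoord c (γ t) (WithLp.toLp 2 fun k =>
    deriv (fun r => toCoord c (γ r) (X r) k) t +
      ∑ i, ∑ j, christoffel c (extChartAt (𝓡 2) c (γ t)) k i j *
        toCoord c (γ t) (velocity γ t) i * toCoord c (γ t) (X t) j)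

/-- The second covariant derivative of a curve, `∇_t` of its velocity, for `t` near `0`. -/
def accel (γ : ℝ → M) : ∀ t, TangentSpace (𝓡 2) (γ t) :=
  covDerivAlong (γ 0) γ (velocity γ)

/-- The third covariant derivative of a curve, for `t` near `0`. -/
def jerk (γ : ℝ → M) : ∀ t, TangentSpace (𝓡 2) (γ t) :=
  covDerivAlong (γ 0) γ (accel γ)

/-- The arclength parameter `s_g(t)`, normalised by `s_g(0) = 0`. -/
def arclength (γ : ℝ → M) (t : ℝ) : ℝ := ∫ u in (0 : ℝ)..t, ‖velocity γ u‖

/-- `[v, w]`: the unit area element of the oriented Riemannian manifold. -/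
def bracket (o : ManifoldOrientation M) (x : M) (v w : TangentSpace (𝓡 2) x) : ℝ :=
  (o.orient x).areaForm v w

/-- The geodesic curvature, for `t` near `0` with nonzero velocity. -/
def geodesicCurvature (o : ManifoldOrientation M) (γ : ℝ → M) (t : ℝ) : ℝ :=
  bracket o (γ t) (velocity γ t) (accel γ t) / ‖velocity γ t‖ ^ 3

/-- `γ` is a `C^∞` curve on an interval around `0` with a 3/2-cusp at `0`. -/
structure IsCusp (o : ManifoldOrientation M) (γ : ℝ → M) : Prop where
  smooth : ∃ δ > 0, ContMDiffOn 𝓘(ℝ, ℝ) (𝓡 2) ∞ γ (Set.Ioo (-δ) δ)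
  singular : velocity γ 0 = 0
  bracket_ne_zero : bracket o (γ 0) (accel γ 0) (jerk γ 0) ≠ 0

/-- The expression `√|s_g| κ_g`, meaningful at parameters with nonzero velocity. -/
def rawNormalizedCurvature (o : ManifoldOrientation M) (γ : ℝ → M) (t : ℝ) : ℝ :=
  √|arclength γ t| * geodesicCurvature o γ t

/-- The normalized curvature function `√|s_g| κ_g`, extended to the singular parameter `0` by its
limit there. -/
def normalizedCurvature (o : ManifoldOrientation M) (γ : ℝ → M) : ℝ → ℝ :=
  Function.update (rawNormalizedCurvature o γ) 0
    (limUnder (𝓝[≠] (0 : ℝ)) (rawNormalizedCurvature o γ))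

section Germs

variable {γ₁ γ₂ : ℝ → M}

lemma covDerivAlong_congr (c : M) {X₁ : ∀ t, TangentSpace (𝓡 2) (γ₁ t)}
    {X₂ : ∀ t, TangentSpace (𝓡 2) (γ₂ t)} {t : ℝ} (h : γ₁ =ᶠ[𝓝 t] γ₂)
    (hv : HEq (velocity γ₁ t) (velocity γ₂ t)) (hX : ∀ᶠ r in 𝓝 t, HEq (X₁ r) (X₂ r)) :
    HEq (covDerivAlong c γ₁ X₁ t) (covDerivAlong c γ₂ X₂ t) := by
  have key : ∀ (x y : M) (v : TangentSpace (𝓡 2) x) (w : TangentSpace (𝓡 2) y), x = y →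
      HEq v w → toCoord c x v = toCoord c y w := by
    rintro x _ v _ rfl h
    rw [eq_of_heq h]
  have key' : ∀ (x y : M) (v w : Plane), x = y → v = w →
      HEq (ofCoord c x v) (ofCoord c y w) := by
    rintro x _ v _ rfl rfl
    rfl
  have h0 := h.self_of_nhds
  have hd : ∀ k, (fun r => toCoord c (γ₁ r) (X₁ r) k) =ᶠ[𝓝 t]
      fun r => toCoord c (γ₂ r) (X₂ r) k := fun k => by
    filter_upwards [h, hX] with r h1 h2
    rw [key _ _ _ _ h1 h2]
  refine key' _ _ _ _ h0 ?_
  congr 1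
  funext k
  rw [(hd k).deriv_eq, key _ _ _ _ h0 hv, key _ _ _ _ h0 hX.self_of_nhds, h0]

lemma velocity_congr {t : ℝ} (h : γ₁ =ᶠ[𝓝 t] γ₂) : HEq (velocity γ₁ t) (velocity γ₂ t) :=
  heq_of_eq (congrArg (fun L : ℝ →L[ℝ] Plane => L 1) h.mfderiv_eq)

lemma accel_congr (h : γ₁ =ᶠ[𝓝 0] γ₂) : ∀ᶠ t in 𝓝 0, HEq (accel γ₁ t) (accel γ₂ t) := by
  filter_upwards [h.eventuallyEq_nhds] with t ht
  unfold accel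
  rw [h.self_of_nhds]
  exact covDerivAlong_congr _ ht (velocity_congr ht)
    (ht.eventuallyEq_nhds.mono fun r hr => velocity_congr hr)

/-- The normalized curvature function depends, as a germ, only on the germ of the curve. -/
lemma normalizedCurvature_congr (o : ManifoldOrientation M) (h : γ₁ =ᶠ[𝓝 0] γ₂) :
    normalizedCurvature o γ₁ =ᶠ[𝓝 0] normalizedCurvature o γ₂ := by
  have hn : ∀ (x y : M) (v : TangentSpace (𝓡 2) x) (w : TangentSpace (𝓡 2) y), x = y →
      HEq v w → ‖v‖ = ‖w‖ := by
    rintro x _ v _ rfl h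
    rw [eq_of_heq h]
  have hb : ∀ (x y : M) (v v' : TangentSpace (𝓡 2) x) (w w' : TangentSpace (𝓡 2) y), x = y →
      HEq v w → HEq v' w' → bracket o x v v' = bracket o y w w' := by
    rintro x _ v v' _ _ rfl h h'
    rw [eq_of_heq h, eq_of_heq h']
  have hs : ∀ᶠ t in 𝓝 (0 : ℝ), ‖velocity γ₁ t‖ = ‖velocity γ₂ t‖ := by
    filter_upwards [h.eventuallyEq_nhds] with t ht
    exact hn _ _ _ _ ht.self_of_nhds (velocity_congr ht)
  have ha : ∀ᶠ t in 𝓝 (0 : ℝ), arclength γ₁ t = arclength γ₂ t := by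
    obtain ⟨ε, hε, hball⟩ := Metric.eventually_nhds_iff_ball.1 hs
    filter_upwards [Metric.ball_mem_nhds (0 : ℝ) hε] with t ht
    refine intervalIntegral.integral_congr fun u hu => hball u ?_
    exact (convex_ball (0 : ℝ) ε).ordConnected.uIcc_subset (Metric.mem_ball_self hε) ht hu
  have hr : rawNormalizedCurvature o γ₁ =ᶠ[𝓝 0] rawNormalizedCurvature o γ₂ := by
    filter_upwards [h.eventuallyEq_nhds, hs, ha, accel_congr h] with t ht h1 h2 h3
    unfold rawNormalizedCurvature geodesicCurvature
    rw [h1, h2, hb _ _ _ _ _ _ ht.self_of_nhds (velocity_congr ht) h3]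
  have hl : limUnder (𝓝[≠] (0 : ℝ)) (rawNormalizedCurvature o γ₁) =
      limUnder (𝓝[≠] (0 : ℝ)) (rawNormalizedCurvature o γ₂) := by
    unfold limUnder
    rw [Filter.map_congr (hr.filter_mono nhdsWithin_le_nhds)]
  filter_upwards [hr] with t ht
  unfold normalizedCurvature
  rw [hl]
  by_cases h0 : t = 0
  · subst h0
    simp
  · simp [Function.update_of_ne h0, ht]

/-- The germs at `0` of curves with a 3/2-cusp at `0`. -/
def CuspGerm (o : ManifoldOrientation M) : Type _ :=
  {G : Germ (𝓝 (0 : ℝ)) M // ∃ γ : ℝ → M, G = (γ : Germ (𝓝 (0 : ℝ)) M) ∧ IsCusp o γ}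

/-- The map sending the germ of a 3/2-cusp to the germ of its normalized curvature function. -/
def normalizedCurvatureMap (o : ManifoldOrientation M) (G : CuspGerm o) :
    Germ (𝓝 (0 : ℝ)) ℝ :=
  G.1.map' (normalizedCurvature o) fun _ _ h => normalizedCurvature_congr o h

/-- The germs at `0` of real-valued `C^∞` functions defined on an interval around `0`. -/
def IsSmoothGerm (f : Germ (𝓝 (0 : ℝ)) ℝ) : Prop :=
  ∃ F : ℝ → ℝ, f = (F : Germ (𝓝 (0 : ℝ)) ℝ) ∧ ∃ δ > 0, ContDiffOn ℝ ∞ F (Set.Ioo (-δ) δ)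

end Germs

end

end CuspCurvature

/-! Work in the chart at the cusp. The coordinate velocity vanishes at `0`, so by Hadamard's lemma
it is `t • u t` with `u` smooth. The covariant acceleration is then `u + t • A` with `A = u' + t •
Γ(u, u)`, and the third derivative at `0` is `2 • u' 0`. The cusp condition thus says that `u 0` and
`u' 0` are independent.

Let `n` be the metric length of `u`. The speed is `|t| * n`, the arclength is `|t| * t * I` with `I
t = ∫ s in 0..1, s * n (t * s)`, and the bracket of velocity and acceleration is `t ^ 2` times that
of `u` and `A`. All powers of `|t|` cancel, leaving `√I * [u, A] / n ^ 3`: smooth, and nonzero at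
`0` exactly by the cusp condition (`rawNormalizedCurvature_eventuallyEq`,
`IsCusp.exists_smooth_normalizedCurvature`).

Conversely, require `n = 1`, so that `I = 1/2`, and solve `[u, A] = √2 * f`. With `u` the unit
vector of direction `(1, p)`, this is a smooth first-order system for the position and `p`, solvable
locally (`exists_coord_curve`). The resulting curve has a cusp because `f 0 ≠ 0`. -/

namespace CuspCurvature

/-! ### Smooth germs on the line: Hadamard's lemma, parameter integrals, ODEs. -/

/-- A function which is `C^∞` on a neighbourhood of `0`. -/
def SmoothNearZero {E : Type*} [NormedAddCommGroup E] [NormedSpace ℝ E] (f : ℝ → E) : Prop :=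
  ∀ᶠ t in 𝓝 (0 : ℝ), ContDiffAt ℝ ∞ f t

section Analysis

variable {E : Type*} [NormedAddCommGroup E] [NormedSpace ℝ E]

lemma SmoothNearZero.congr {f g : ℝ → E} (hf : SmoothNearZero f) (h : g =ᶠ[𝓝 0] f) :
    SmoothNearZero g := by
  filter_upwards [hf, h.eventuallyEq_nhds] with t h1 h2
  exact h1.congr_of_eventuallyEq h2

lemma smoothNearZero_of_contDiffOn {f : ℝ → E} {δ : ℝ} (hδ : 0 < δ)
    (hf : ContDiffOn ℝ ∞ f (Set.Ioo (-δ) δ)) : SmoothNearZero f := by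
  filter_upwards [Ioo_mem_nhds (neg_lt_zero.2 hδ) hδ] with t ht
  exact hf.contDiffAt (Ioo_mem_nhds ht.1 ht.2)

lemma exists_symm_Ioo_of_eventually {p : ℝ → Prop} (h : ∀ᶠ t in 𝓝 (0 : ℝ), p t) :
    ∃ δ > 0, ∀ t ∈ Set.Ioo (-δ) δ, p t := by
  obtain ⟨δ, hδ, hb⟩ := Metric.eventually_nhds_iff_ball.1 h
  refine ⟨δ, hδ, fun t ht => hb t ?_⟩
  rw [Metric.mem_ball, dist_zero_right, Real.norm_eq_abs, abs_lt]
  exact ht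

lemma SmoothNearZero.exists_contDiffOn {f : ℝ → E} (hf : SmoothNearZero f) :
    ∃ δ > 0, ContDiffOn ℝ ∞ f (Set.Ioo (-δ) δ) := by
  obtain ⟨δ, hδ, h⟩ := exists_symm_Ioo_of_eventually hf
  exact ⟨δ, hδ, fun t ht => (h t ht).contDiffWithinAt⟩

lemma contDiffAt_deriv {f : ℝ → E} {t : ℝ} (hf : ContDiffAt ℝ ∞ f t) :
    ContDiffAt ℝ ∞ (deriv f) t := by
  have h := (hf.fderiv_right (m := ∞) (by simp)).clm_apply (contDiffAt_const (c := (1 : ℝ)))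
  exact h

lemma SmoothNearZero.deriv {f : ℝ → E} (hf : SmoothNearZero f) : SmoothNearZero (deriv f) :=
  hf.mono fun _ => contDiffAt_deriv

lemma SmoothNearZero.contDiffAt {f : ℝ → E} (hf : SmoothNearZero f) : ContDiffAt ℝ ∞ f 0 :=
  hf.self_of_nhds

/-- A bump function equal to `1` near `0` cuts `f` off inside the ball where it is smooth. Parameter
integrals can then be differentiated without tracking domains. -/
lemma SmoothNearZero.exists_contDiff {f : ℝ → E} (hf : SmoothNearZero f) :
    ∃ g : ℝ → E, ContDiff ℝ ∞ g ∧ f =ᶠ[𝓝 0] g := by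
  obtain ⟨r, hr, hb⟩ := Metric.eventually_nhds_iff_ball.1 hf
  let χ : ContDiffBump (0 : ℝ) := ⟨r / 4, r / 2, by positivity, by linarith⟩
  refine ⟨fun t => χ t • f t, contDiff_iff_contDiffAt.2 fun t => ?_, ?_⟩
  · by_cases ht : t ∈ Metric.ball (0 : ℝ) r
    · exact χ.contDiffAt.smul (hb t ht)
    · have : t ∉ tsupport χ := by
        rw [χ.tsupport_eq]
        intro h
        exact ht (Metric.closedBall_subset_ball (by change r / 2 < r; linarith) h)
      refine (contDiffAt_const (c := (0 : E))).congr_of_eventuallyEq ?_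
      filter_upwards [notMem_tsupport_iff_eventuallyEq.1 this] with x hx
      simp [hx]
  · filter_upwards [χ.eventuallyEq_one] with t ht
    simp [ht]

/-- Each derivative in `t` brings down a factor `s`; allowing every weight `s ^ m` makes the family
closed under differentiation, so smoothness follows by induction. -/
lemma hasDerivAt_integral_pow_smul_comp_mul [CompleteSpace E] {g : ℝ → E}
    (hg : ContDiff ℝ 1 g) (m : ℕ) (t : ℝ) :
    HasDerivAt (fun t => ∫ s in (0 : ℝ)..1, s ^ m • g (t * s))
      (∫ s in (0 : ℝ)..1, s ^ (m + 1) • deriv g (t * s)) t := by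
  have hg' : Continuous (deriv g) := hg.continuous_deriv le_rfl
  have hc : Continuous fun q : ℝ × ℝ => ‖q.2 ^ (m + 1) • deriv g (q.1 * q.2)‖ := by fun_prop
  -- Compactness gives a constant bound for the differentiated integrand, as dominated
  -- differentiation requires.
  obtain ⟨C, hC⟩ := ((isCompact_closedBall t 1).prod
    (isCompact_Icc (a := (0 : ℝ)) (b := 1))).bddAbove_image hc.continuousOn
  refine (intervalIntegral.hasDerivAt_integral_of_dominated_loc_of_deriv_le
    (F' := fun x s => s ^ (m + 1) • deriv g (x * s)) (bound := fun _ => C)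
    (Metric.closedBall_mem_nhds t one_pos) (.of_forall fun x => ?_) ?_ ?_ ?_ ?_ ?_).2
  · have : Continuous fun s => s ^ m • g (x * s) := by
      have := hg.continuous
      fun_prop
    exact this.aestronglyMeasurable
  · have : Continuous fun s => s ^ m • g (t * s) := by
      have := hg.continuous
      fun_prop
    exact this.intervalIntegrable _ _
  · have : Continuous fun s => s ^ (m + 1) • deriv g (t * s) := by fun_prop
    exact this.aestronglyMeasurable
  · refine .of_forall fun s hs x hx => hC ⟨(x, s), ⟨hx, ?_⟩, rfl⟩
    rw [Set.uIoc_of_le zero_le_one] at hs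
    exact Set.Ioc_subset_Icc_self hs
  · simp
  · refine .of_forall fun s _ x _ => ?_
    have h1 : HasDerivAt g (deriv g (x * s)) (x * s) :=
      (hg.differentiable one_ne_zero _).hasDerivAt
    have h2 := (h1.scomp x (hasDerivAt_mul_const s)).const_smul (s ^ m)
    rwa [smul_smul, ← pow_succ] at h2

lemma contDiff_integral_pow_smul_comp_mul [CompleteSpace E] {g : ℝ → E}
    (hg : ContDiff ℝ ∞ g) (m : ℕ) :
    ContDiff ℝ ∞ (fun t => ∫ s in (0 : ℝ)..1, s ^ m • g (t * s)) := by
  rw [contDiff_infty]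
  intro n
  induction n generalizing g m with
  | zero =>
    refine contDiff_zero.2 (continuous_iff_continuousAt.2 fun t => ?_)
    exact (hasDerivAt_integral_pow_smul_comp_mul (hg.of_le (by simp)) m t).continuousAt
  | succ n ih =>
    have h := hasDerivAt_integral_pow_smul_comp_mul (hg.of_le (by simp)) m
    rw [Nat.cast_succ, contDiff_succ_iff_deriv]
    refine ⟨fun t => (h t).differentiableAt, by simp, ?_⟩
    rw [funext fun t => (h t).deriv]
    exact ih (contDiff_infty_iff_deriv.1 hg).2 (m + 1)

/-- The average of a smooth function over the segments issuing from `0`, with weight `s`. -/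
lemma SmoothNearZero.integral_pow_smul_comp_mul [CompleteSpace E] {f : ℝ → E}
    (hf : SmoothNearZero f) (m : ℕ) :
    SmoothNearZero fun t => ∫ s in (0 : ℝ)..1, s ^ m • f (t * s) := by
  obtain ⟨g, hg, hfg⟩ := hf.exists_contDiff
  refine SmoothNearZero.congr
    (.of_forall fun t => (contDiff_integral_pow_smul_comp_mul hg m).contDiffAt) ?_
  obtain ⟨r, hr, hb⟩ := Metric.eventually_nhds_iff_ball.1 hfg
  filter_upwards [Metric.ball_mem_nhds (0 : ℝ) hr] with t ht
  refine intervalIntegral.integral_congr fun s hs => ?_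
  rw [Set.uIcc_of_le zero_le_one] at hs
  rw [← hb (t * s)]
  rw [mem_ball_zero_iff] at ht ⊢
  rw [norm_mul, Real.norm_of_nonneg hs.1]
  exact (mul_le_of_le_one_right (norm_nonneg _) hs.2).trans_lt ht

/-- **Hadamard's lemma**. -/
lemma SmoothNearZero.exists_eq_smul [CompleteSpace E] {f : ℝ → E} (hf : SmoothNearZero f)
    (h0 : f 0 = 0) : ∃ g : ℝ → E, SmoothNearZero g ∧ ∀ᶠ t in 𝓝 (0 : ℝ), f t = t • g t := by
  obtain ⟨F, hF, hfF⟩ := hf.exists_contDiff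
  have hF' : ContDiff ℝ ∞ (_root_.deriv F) := (contDiff_infty_iff_deriv.1 hF).2
  refine ⟨fun t => ∫ s in (0 : ℝ)..1, s ^ 0 • _root_.deriv F (t * s),
    .of_forall fun t => (contDiff_integral_pow_smul_comp_mul hF' 0).contDiffAt, ?_⟩
  filter_upwards [hfF] with t ht
  have h1 := intervalIntegral.integral_eq_sub_of_hasDerivAt (a := 0) (b := t) (f := F)
    (fun x _ => (hF.differentiable (by simp) x).hasDerivAt)
    (hF'.continuous.intervalIntegrable _ _)
  simp only [pow_zero, one_smul]
  rw [intervalIntegral.smul_integral_comp_mul_left, mul_zero, mul_one, h1, ht,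
    ← hfF.self_of_nhds, h0, sub_zero]

/-- Substitute `x = t * s`; since `s ≥ 0`, `|t * s| = |t| * s`. Applied to the speed `|x| * n x`,
this isolates the non-smooth factor `|t| * t` of the arclength. -/
lemma integral_abs_mul_eq (n : ℝ → ℝ) (t : ℝ) :
    ∫ x in (0 : ℝ)..t, |x| * n x = |t| * t * ∫ s in (0 : ℝ)..1, s ^ 1 • n (t * s) := by
  have h := intervalIntegral.smul_integral_comp_mul_left (a := 0) (b := 1)
    (fun x : ℝ => |x| * n x) t
  rw [mul_zero, mul_one] at h
  rw [← h, smul_eq_mul, mul_comm |t| t, mul_assoc, ← intervalIntegral.integral_const_mul |t|]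
  refine congrArg (t * ·) (intervalIntegral.integral_congr fun s hs => ?_)
  rw [Set.uIcc_of_le zero_le_one] at hs
  simp only [abs_mul, abs_of_nonneg hs.1, smul_eq_mul]
  ring

/-- Bootstrapping: if `β` is `C^n`, so is its derivative `V ∘ β`, hence `β` is `C^(n+1)`. -/
lemma contDiffOn_of_hasDerivAt_comp {V : E → E} {β : ℝ → E} {I : Set ℝ} (hI : IsOpen I)
    (hβ : ∀ t ∈ I, HasDerivAt β (V (β t)) t) (hV : ∀ t ∈ I, ContDiffAt ℝ ∞ V (β t)) :
    ContDiffOn ℝ ∞ β I := by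
  rw [contDiffOn_infty]
  intro n
  induction n with
  | zero => exact contDiffOn_zero.2 fun t ht => (hβ t ht).continuousAt.continuousWithinAt
  | succ n ih =>
    rw [Nat.cast_succ, contDiffOn_succ_iff_deriv_of_isOpen hI]
    refine ⟨fun t ht => (hβ t ht).differentiableAt.differentiableWithinAt, by simp, ?_⟩
    refine ContDiffOn.congr (fun t ht => ?_) fun t ht => (hβ t ht).deriv
    exact ((hV t ht).of_le (mod_cast le_top)).comp_contDiffWithinAt t (ih t ht)

/-- Local existence of smooth solutions of non-autonomous ordinary differential equations. -/
lemma exists_smooth_solution [CompleteSpace E] {G : ℝ × E → E} {x₀ : E}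
    (hG : ∀ᶠ q in 𝓝 ((0 : ℝ), x₀), ContDiffAt ℝ ∞ G q) :
    ∃ α : ℝ → E, α 0 = x₀ ∧ SmoothNearZero α ∧ ∀ᶠ t in 𝓝 (0 : ℝ), HasDerivAt α (G (t, α t)) t := by
  -- Time becomes an extra coordinate of speed `1`, making the equation autonomous; `hfst` later
  -- identifies this coordinate with `t`.
  let V : ℝ × E → ℝ × E := fun q => (1, G q)
  have hV : ∀ q, ContDiffAt ℝ ∞ G q → ContDiffAt ℝ ∞ V q := fun q hq => contDiffAt_const.prodMk hq
  obtain ⟨β, hβ0, ε, hε, hβ⟩ := ((hV _ hG.self_of_nhds).of_le (m := 1)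
    (by simp)).exists_forall_mem_closedBall_exists_eq_forall_mem_Ioo_hasDerivAt₀ 0
  have hβc : ContinuousAt β 0 := (hβ 0 ⟨by linarith, by linarith⟩).continuousAt
  rw [← hβ0] at hG
  have hev : ∀ᶠ t in 𝓝 (0 : ℝ), HasDerivAt β (V (β t)) t ∧ ContDiffAt ℝ ∞ V (β t) := by
    filter_upwards [Ioo_mem_nhds (a := (0 : ℝ) - ε) (b := 0 + ε) (by linarith) (by linarith),
      hβc.eventually hG] with t h1 h2
    exact ⟨hβ t h1, hV _ h2⟩
  obtain ⟨δ, hδ, hI⟩ := exists_symm_Ioo_of_eventually hev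
  have hmem : Set.Ioo (-δ) δ ∈ 𝓝 (0 : ℝ) := Ioo_mem_nhds (by linarith) hδ
  have hsm : ContDiffOn ℝ ∞ β (Set.Ioo (-δ) δ) :=
    contDiffOn_of_hasDerivAt_comp isOpen_Ioo (fun t ht => (hI t ht).1) fun t ht => (hI t ht).2
  have hfst : ∀ t ∈ Set.Ioo (-δ) δ, (β t).1 = t := by
    have hd : ∀ t ∈ Set.Ioo (-δ) δ, HasDerivAt (fun t => (β t).1 - t) 0 t := fun t ht => by
      have := ((hasFDerivAt_fst (𝕜 := ℝ) (p := β t)).comp_hasDerivAt t (hI t ht).1).sub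
        (hasDerivAt_id t)
      simp only [V, ContinuousLinearMap.coe_fst', sub_self] at this
      exact this
    intro t ht
    have := isOpen_Ioo.is_const_of_deriv_eq_zero isPreconnected_Ioo
      (fun x hx => (hd x hx).differentiableAt.differentiableWithinAt)
      (fun x hx => (hd x hx).deriv) ht (mem_of_mem_nhds hmem)
    simpa [hβ0, sub_eq_zero] using this
  refine ⟨fun t => (β t).2, by simp [hβ0], ?_, ?_⟩
  · filter_upwards [hmem] with t ht
    exact contDiffAt_snd.comp t (hsm.contDiffAt (isOpen_Ioo.mem_nhds ht))
  · filter_upwards [hmem] with t ht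
    have := (hasFDerivAt_snd (𝕜 := ℝ) (p := β t)).comp_hasDerivAt t (hI t ht).1
    have h2 : (t, (β t).2) = β t := Prod.ext (hfst t ht).symm rfl
    rw [h2]
    exact this

end Analysis

end CuspCurvature

namespace CuspCurvature

noncomputable section

variable {M : Type*} [TopologicalSpace M] [ChartedSpace Plane M] [IsManifold (𝓡 2) ∞ M]

/-! ### The metric, area element and Christoffel symbols in a chart. -/

/-- The coordinate determinant of two vectors of the plane. -/
def cross (u v : Plane) : ℝ := u 0 * v 1 - u 1 * v 0

lemma ofCoord_toCoord {c x : M} (hx : x ∈ (chartAt Plane c).source)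
    (v : TangentSpace (𝓡 2) x) : ofCoord c x (toCoord c x v) = v :=
  (trivializationAt Plane (TangentSpace (𝓡 2) : M → Type _) c).symmL_continuousLinearMapAt
    (by simpa using hx) v

lemma toCoord_ofCoord {c x : M} (hx : x ∈ (chartAt Plane c).source) (v : Plane) :
    toCoord c x (ofCoord c x v) = v :=
  (trivializationAt Plane (TangentSpace (𝓡 2) : M → Type _) c).continuousLinearMapAt_symmL
    (by simpa using hx) v

lemma hasDerivAt_of_hasFDerivAt_comp {f : ℝ → Plane} {t : ℝ} {L₁ : Plane →L[ℝ] Plane}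
    {L₂ : ℝ →L[ℝ] Plane} (h : HasFDerivAt f (L₁.comp L₂) t) : HasDerivAt f (L₁ (L₂ 1)) t :=
  h.hasDerivAt

lemma hasDerivAt_extChartAt_comp {c : M} {γ : ℝ → M} {t : ℝ}
    (hx : γ t ∈ (chartAt Plane c).source) (hγ : MDifferentiableAt 𝓘(ℝ, ℝ) (𝓡 2) γ t) :
    HasDerivAt (fun r => extChartAt (𝓡 2) c (γ r)) (toCoord c (γ t) (velocity γ t)) t := by
  have h1 : MDifferentiableAt (𝓡 2) 𝓘(ℝ, Plane) (extChartAt (𝓡 2) c) (γ t) :=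
    mdifferentiableAt_extChartAt hx
  unfold toCoord velocity
  rw [TangentBundle.continuousLinearMapAt_trivializationAt hx]
  exact hasDerivAt_of_hasFDerivAt_comp
    (hasMFDerivAt_iff_hasFDerivAt.1 (h1.hasMFDerivAt.comp t hγ.hasMFDerivAt))

lemma ofCoord_eq_sum (c x : M) (v : Plane) :
    ofCoord c x v = v 0 • ofCoord c x (basisVec 0) + v 1 • ofCoord c x (basisVec 1) := by
  have hv : v = v 0 • basisVec 0 + v 1 • basisVec 1 := by
    ext i
    fin_cases i <;> simp [basisVec]
  unfold ofCoord
  conv_lhs => rw [hv]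
  rw [map_add, map_smul, map_smul]

section Christoffel

variable [RiemannianBundle (fun x : M => TangentSpace (𝓡 2) x)]

/-- The coordinate expression of the metric as a quadratic form. -/
def metricQuad (c : M) (y u : Plane) : ℝ :=
  ∑ i, ∑ j, metricMatrix c y i j * u i * u j

/-- The vector with components `∑ i j, Γ^k_ij u^i v^j`. -/
def christoffelVec (c : M) (y u v : Plane) : Plane :=
  WithLp.toLp 2 fun k => ∑ i, ∑ j, christoffel c y k i j * u i * v j

lemma metricMatrix_extChartAt {c x : M} (hx : x ∈ (chartAt Plane c).source) (i j : Fin 2) :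
    metricMatrix c (extChartAt (𝓡 2) c x) i j =
      inner ℝ (ofCoord c x (basisVec i)) (ofCoord c x (basisVec j)) := by
  -- The chart followed by its inverse returns `x` only propositionally, and the tangent spaces
  -- depend on the point, so the equality is substituted for a general `x'`.
  have h : ∀ x' : M, x' = x → inner ℝ (ofCoord c x' (basisVec i)) (ofCoord c x' (basisVec j)) =
      inner ℝ (ofCoord c x (basisVec i)) (ofCoord c x (basisVec j)) := by
    rintro _ rfl
    rfl
  exact h _ ((extChartAt (𝓡 2) c).left_inv (by simpa using hx))

lemma inner_eq_sum {c x : M} (hx : x ∈ (chartAt Plane c).source)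
    (v w : TangentSpace (𝓡 2) x) :
    inner ℝ v w = ∑ i, ∑ j, metricMatrix c (extChartAt (𝓡 2) c x) i j *
      toCoord c x v i * toCoord c x w j := by
  conv_lhs => rw [← ofCoord_toCoord hx v, ← ofCoord_toCoord hx w, ofCoord_eq_sum,
    ofCoord_eq_sum c x (toCoord c x w)]
  simp only [metricMatrix_extChartAt hx, Fin.sum_univ_two, inner_add_left,
    inner_add_right, real_inner_smul_left, real_inner_smul_right]
  ring

lemma norm_eq_sqrt_metricQuad {c x : M} (hx : x ∈ (chartAt Plane c).source)
    (v : TangentSpace (𝓡 2) x) :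
    ‖v‖ = √(metricQuad c (extChartAt (𝓡 2) c x) (toCoord c x v)) := by
  rw [metricQuad, ← inner_eq_sum hx, real_inner_self_eq_norm_sq, Real.sqrt_sq (norm_nonneg _)]

lemma metricQuad_pos {c : M} {y : Plane} (hy : y ∈ (extChartAt (𝓡 2) c).target) {u : Plane}
    (hu : u ≠ 0) : 0 < metricQuad c y u := by
  have hx : (extChartAt (𝓡 2) c).symm y ∈ (chartAt Plane c).source := by
    simpa using (extChartAt (𝓡 2) c).map_target hy
  have h := inner_eq_sum hx (ofCoord c _ u) (ofCoord c _ u)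
  rw [toCoord_ofCoord hx, (extChartAt (𝓡 2) c).right_inv hy] at h
  rw [metricQuad, ← h, real_inner_self_eq_norm_sq]
  have : ofCoord c ((extChartAt (𝓡 2) c).symm y) u ≠ 0 := fun h0 => hu <| by
    rw [← toCoord_ofCoord hx u, h0]
    exact map_zero _
  positivity

lemma metricMatrix_symm (c : M) (y : Plane) : metricMatrix c y 1 0 = metricMatrix c y 0 1 := by
  simp only [metricMatrix, Matrix.of_apply]
  exact real_inner_comm _ _

lemma metricMatrix_det_pos {c : M} {y : Plane} (hy : y ∈ (extChartAt (𝓡 2) c).target) :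
    0 < (metricMatrix c y).det := by
  have h1 := metricQuad_pos hy (u := basisVec 0) (fun h => by
    simpa [basisVec] using congrArg (fun v : Plane => v 0) h)
  have h00 : 0 < metricMatrix c y 0 0 := by
    simpa [metricQuad, Fin.sum_univ_two, basisVec] using h1
  -- On the vector `(-g₀₁, g₀₀)` the quadratic form takes the value `g₀₀ * det g`.
  have h2 := metricQuad_pos hy
    (u := WithLp.toLp 2 ![-metricMatrix c y 0 1, metricMatrix c y 0 0]) (fun h =>
      h00.ne' (by simpa using congrArg (fun v : Plane => v 1) h))
  have h3 : 0 < metricMatrix c y 0 0 * (metricMatrix c y).det := by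
    rw [Matrix.det_fin_two]
    refine h2.trans_eq ?_
    simp only [metricQuad, Fin.sum_univ_two, metricMatrix_symm]
    simp
    ring
  exact pos_of_mul_pos_right h3 h00.le

/-- This is the Gram identity `⟪a, b⟫² + [a, b]² = |a|² |b|²` for the coordinate frame. -/
lemma abs_areaForm_ofCoord_basisVec (o : ManifoldOrientation M) (c : M) (x : M)
    (hx : x ∈ (chartAt Plane c).source) :
    |(o.orient x).areaForm (ofCoord c x (basisVec 0)) (ofCoord c x (basisVec 1))| =
      √(metricMatrix c (extChartAt (𝓡 2) c x)).det := by
  have h := (o.orient x).inner_sq_add_areaForm_sq (ofCoord c x (basisVec 0))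
    (ofCoord c x (basisVec 1))
  rw [← Real.sqrt_sq_eq_abs]
  congr 1
  rw [Matrix.det_fin_two, metricMatrix_symm]
  simp only [metricMatrix_extChartAt hx, real_inner_self_eq_norm_sq]
  linarith

/-- The area form is the determinant relative to any positively oriented orthonormal basis, and
determinants between equally oriented bases are positive. -/
lemma areaForm_pos_of_orientation_eq {E : Type*} [NormedAddCommGroup E] [InnerProductSpace ℝ E]
    [Fact (Module.finrank ℝ E = 2)] {o : Orientation ℝ E (Fin 2)} (b : Module.Basis (Fin 2) ℝ E)
    (h : b.orientation = o) : 0 < o.areaForm (b 0) (b 1) := by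
  let e := o.finOrthonormalBasis two_pos Fact.out
  have he : e.toBasis.orientation = o := o.finOrthonormalBasis_orientation two_pos Fact.out
  have hb : ![b 0, b 1] = b := by
    ext i
    fin_cases i <;> rfl
  rw [o.areaForm_to_volumeForm, o.volumeForm_robust e he, hb,
    ← Module.Basis.orientation_eq_iff_det_pos, he, h]

lemma areaForm_eq_mul_cross (o : ManifoldOrientation M) {c x : M}
    (hx : x ∈ (chartAt Plane c).source) (v w : TangentSpace (𝓡 2) x) :
    (o.orient x).areaForm v w =
      (o.orient x).areaForm (ofCoord c x (basisVec 0)) (ofCoord c x (basisVec 1)) *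
        cross (toCoord c x v) (toCoord c x w) := by
  conv_lhs => rw [← ofCoord_toCoord hx v, ← ofCoord_toCoord hx w, ofCoord_eq_sum,
    ofCoord_eq_sum c x (toCoord c x w)]
  have hs := (o.orient x).areaForm_swap (ofCoord c x (basisVec 1)) (ofCoord c x (basisVec 0))
  simp only [map_add, map_smul, LinearMap.add_apply, LinearMap.smul_apply, smul_eq_mul,
    Orientation.areaForm_apply_self, hs, cross]
  ring

/-- In a chart, the area element is `±√(det g)` times the determinant, with a constant sign. -/
lemma exists_sign_bracket_eq (o : ManifoldOrientation M) (c : M) :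
    ∃ ε : ℝ, ε ^ 2 = 1 ∧ ∀ᶠ x in 𝓝 c, ∀ v w : TangentSpace (𝓡 2) x,
      bracket o x v w = ε * √(metricMatrix c (extChartAt (𝓡 2) c x)).det *
        cross (toCoord c x v) (toCoord c x w) := by
  obtain ⟨o₀, ho⟩ := o.locally_constant c
  let b₀ : Module.Basis (Fin 2) ℝ Plane := (EuclideanSpace.basisFun (Fin 2) ℝ).toBasis
  -- Only the sign `s` of the area of the coordinate frame near `c` is needed, its absolute value
  -- being `√(det g)`.
  have hb : ∀ s : ℝ, s ^ 2 = 1 → (∀ᶠ x in 𝓝 c, x ∈ (chartAt Plane c).source →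
      0 < s * (o.orient x).areaForm (ofCoord c x (basisVec 0)) (ofCoord c x (basisVec 1))) →
      ∃ ε : ℝ, ε ^ 2 = 1 ∧ ∀ᶠ x in 𝓝 c, ∀ v w : TangentSpace (𝓡 2) x,
        bracket o x v w = ε * √(metricMatrix c (extChartAt (𝓡 2) c x)).det *
          cross (toCoord c x v) (toCoord c x w) := by
    intro s hs1 hs
    refine ⟨s, hs1, ?_⟩
    filter_upwards [hs, (chartAt Plane c).open_source.mem_nhds (mem_chart_source Plane c)]
      with x h hx v w
    rw [bracket, areaForm_eq_mul_cross o hx, ← abs_areaForm_ofCoord_basisVec o c x hx]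
    congr 1
    have habs := abs_of_pos (h hx)
    rw [abs_mul, (pow_eq_one_iff_of_nonneg (abs_nonneg s) two_ne_zero).1 (by rw [sq_abs, hs1]), one_mul] at habs
    rw [habs, ← mul_assoc, ← pow_two, hs1, one_mul]
  have hbasis : ∀ x (hx : x ∈ (trivializationAt Plane (TangentSpace (𝓡 2) : M → Type _) c).baseSet),
      ∃ b : Module.Basis (Fin 2) ℝ (TangentSpace (𝓡 2) x),
        (∀ i, b i = ofCoord c x (basisVec i)) ∧
        Orientation.map (Fin 2) ((trivializationAt Plane (TangentSpace (𝓡 2) : M → Type _)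
          c).continuousLinearEquivAt ℝ x hx).toLinearEquiv b.orientation = b₀.orientation := by
    intro x hx
    refine ⟨b₀.map ((trivializationAt Plane (TangentSpace (𝓡 2) : M → Type _)
          c).continuousLinearEquivAt ℝ x hx).toLinearEquiv.symm, fun i => ?_, ?_⟩
    · have : b₀ i = basisVec i := by simp [b₀, basisVec]
      rw [Module.Basis.map_apply, this]
      exact congrFun
        (Trivialization.symm_continuousLinearEquivAt_eq (R := ℝ) _ hx) (basisVec i)
    · rw [← Module.Basis.orientation_map]
      exact congrArg _ (Module.Basis.eq_of_apply_eq fun i => by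
        rw [Module.Basis.map_apply, Module.Basis.map_apply]
        exact LinearEquiv.apply_symm_apply _ _)
  rcases b₀.orientation_eq_or_eq_neg o₀ with h0 | h0
  · refine hb 1 (by norm_num) ?_
    filter_upwards [ho] with x h hx
    have hx' : x ∈ (trivializationAt Plane (TangentSpace (𝓡 2) : M → Type _) c).baseSet := by
      simpa using hx
    obtain ⟨b, hb1, hb2⟩ := hbasis x hx'
    have h3 := areaForm_pos_of_orientation_eq (o := o.orient x) b
      ((Orientation.map (Fin 2) _).injective (hb2.trans (h0.symm.trans (h hx').symm)))
    rwa [one_mul, ← hb1, ← hb1]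
  -- Here the coordinate frame is positive for the opposite orientation, whose area form is the
  -- negative.
  · refine hb (-1) (by norm_num) ?_
    filter_upwards [ho] with x h hx
    have hx' : x ∈ (trivializationAt Plane (TangentSpace (𝓡 2) : M → Type _) c).baseSet := by
      simpa using hx
    obtain ⟨b, hb1, hb2⟩ := hbasis x hx'
    have h3 := areaForm_pos_of_orientation_eq (o := -o.orient x) b
      ((Orientation.map (Fin 2) _).injective (hb2.trans (by
        rw [Orientation.map_neg, h hx', h0]
        exact (neg_neg (G := Module.Ray ℝ (Plane [⋀^Fin 2]→ₗ[ℝ] ℝ)) _).symm)))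
    rw [Orientation.areaForm_neg_orientation] at h3
    rw [neg_one_mul, ← hb1, ← hb1]
    exact h3

variable [IsContMDiffRiemannianBundle (𝓡 2) ∞ Plane (fun x : M => TangentSpace (𝓡 2) x)]

/-- The coordinate fields are constant in the trivialization, hence smooth sections, and the metric
pairs smooth sections smoothly. -/
lemma contDiffAt_metricMatrix {c : M} {y : Plane} (hy : y ∈ (extChartAt (𝓡 2) c).target)
    (i j : Fin 2) : ContDiffAt ℝ ∞ (fun z => metricMatrix c z i j) y := by
  have hx : (extChartAt (𝓡 2) c).symm y ∈ (chartAt Plane c).source := by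
    simpa using (extChartAt (𝓡 2) c).map_target hy
  have hb : ∀ i, ContMDiffAt (𝓡 2) ((𝓡 2).prod 𝓘(ℝ, Plane)) ∞
      (fun x : M => (TotalSpace.mk' Plane x (ofCoord c x (basisVec i)) : TangentBundle (𝓡 2) M))
      ((extChartAt (𝓡 2) c).symm y) := fun i => by
    rw [(trivializationAt Plane (TangentSpace (𝓡 2) : M → Type _) c).contMDiffAt_section_iff
      (by simpa using hx)]
    refine (contMDiffAt_const (c := basisVec i)).congr_of_eventuallyEq ?_
    filter_upwards [(chartAt Plane c).open_source.mem_nhds hx] with x hx'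
    have hx'' : x ∈ (trivializationAt Plane (TangentSpace (𝓡 2) : M → Type _) c).baseSet := by
      simpa using hx'
    have := toCoord_ofCoord hx' (basisVec i)
    rwa [toCoord, Trivialization.continuousLinearMapAt_apply,
      Trivialization.linearMapAt_apply, if_pos hx''] at this
  have h := (hb i).inner_bundle (hb j)
  have hs : ContMDiffAt 𝓘(ℝ, Plane) (𝓡 2) ∞ (extChartAt (𝓡 2) c).symm y :=
    (contMDiffOn_extChartAt_symm c).contMDiffAt
      ((isOpen_extChartAt_target c).mem_nhds hy)
  exact (h.comp y hs).contDiffAt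

lemma contDiffAt_christoffel {c : M} {y : Plane} (hy : y ∈ (extChartAt (𝓡 2) c).target)
    (k i j : Fin 2) : ContDiffAt ℝ ∞ (fun z => christoffel c z k i j) y := by
  have hd : ∀ k i j, ContDiffAt ℝ ∞ (fun z => metricDeriv c z k i j) y := fun k i j =>
    ((contDiffAt_metricMatrix hy i j).fderiv_right (m := ∞) (by simp)).clm_apply contDiffAt_const
  have hinv : ∀ k l, ContDiffAt ℝ ∞ (fun z => (metricMatrix c z)⁻¹ k l) y := fun k l => by
    have hdet : ContDiffAt ℝ ∞ (fun z => (metricMatrix c z).det) y := by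
      simp only [Matrix.det_fin_two]
      exact ((contDiffAt_metricMatrix hy _ _).mul (contDiffAt_metricMatrix hy _ _)).sub
        ((contDiffAt_metricMatrix hy _ _).mul (contDiffAt_metricMatrix hy _ _))
    have hadj : ContDiffAt ℝ ∞ (fun z => (metricMatrix c z).adjugate k l) y := by
      simp only [Matrix.adjugate_fin_two]
      fin_cases k <;> fin_cases l <;> simp
      · exact contDiffAt_metricMatrix hy _ _
      · exact (contDiffAt_metricMatrix hy _ _).neg
      · exact (contDiffAt_metricMatrix hy _ _).neg
      · exact contDiffAt_metricMatrix hy _ _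
    simp only [Matrix.inv_def, Ring.inverse_eq_inv', Matrix.smul_apply, smul_eq_mul]
    exact (hdet.inv (metricMatrix_det_pos hy).ne').mul hadj
  unfold christoffel
  exact contDiffAt_const.mul (ContDiffAt.sum fun l _ =>
    (hinv k l).mul (((hd _ _ _).add (hd _ _ _)).sub (hd _ _ _)))

end Christoffel

end

end CuspCurvature

namespace CuspCurvature

noncomputable section

variable {M : Type*} [TopologicalSpace M] [ChartedSpace Plane M] [IsManifold (𝓡 2) ∞ M]

/-! ### Singular curves in coordinates: velocity, acceleration, jerk and curvature. -/

lemma cross_smul_left (a : ℝ) (u v : Plane) : cross (a • u) v = a * cross u v := by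
  simp [cross]
  ring

lemma cross_smul_right (a : ℝ) (u v : Plane) : cross u (a • v) = a * cross u v := by
  simp [cross]
  ring

lemma cross_add_right (u v w : Plane) : cross u (v + w) = cross u v + cross u w := by
  simp [cross]
  ring

lemma cross_self (u : Plane) : cross u u = 0 := by
  simp [cross]
  ring

lemma contDiffAt_apply {F : Type*} [NormedAddCommGroup F] [NormedSpace ℝ F] {u : F → Plane}
    {p : F} (hu : ContDiffAt ℝ ∞ u p) (i : Fin 2) : ContDiffAt ℝ ∞ (fun q => u q i) p :=
  (contDiffAt_piLp 2).1 hu i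

lemma contDiffAt_cross {F : Type*} [NormedAddCommGroup F] [NormedSpace ℝ F] {u v : F → Plane}
    {p : F} (hu : ContDiffAt ℝ ∞ u p) (hv : ContDiffAt ℝ ∞ v p) :
    ContDiffAt ℝ ∞ (fun q => cross (u q) (v q)) p :=
  ((contDiffAt_apply hu 0).mul (contDiffAt_apply hv 1)).sub
    ((contDiffAt_apply hu 1).mul (contDiffAt_apply hv 0))

/-- The coordinates of a curve near `0`, in the preferred chart around its value at `0`. -/
def coordCurve (γ : ℝ → M) (t : ℝ) : Plane := extChartAt (𝓡 2) (γ 0) (γ t)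

omit [IsManifold (𝓡 2) ∞ M] in
lemma eventually_mem_chart_source {γ : ℝ → M}
    (hγ : ∀ᶠ t in 𝓝 (0 : ℝ), ContMDiffAt 𝓘(ℝ, ℝ) (𝓡 2) ∞ γ t) :
    ∀ᶠ t in 𝓝 (0 : ℝ), γ t ∈ (chartAt Plane (γ 0)).source :=
  hγ.self_of_nhds.continuousAt.eventually
    ((chartAt Plane (γ 0)).open_source.mem_nhds (mem_chart_source Plane (γ 0)))

lemma smoothNearZero_coordCurve {γ : ℝ → M}
    (hγ : ∀ᶠ t in 𝓝 (0 : ℝ), ContMDiffAt 𝓘(ℝ, ℝ) (𝓡 2) ∞ γ t) :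
    SmoothNearZero (coordCurve γ) := by
  filter_upwards [hγ, eventually_mem_chart_source hγ] with t h1 h2
  have h3 : ContMDiffAt (𝓡 2) 𝓘(ℝ, Plane) ∞ (extChartAt (𝓡 2) (γ 0)) (γ t) :=
    contMDiffAt_extChartAt' h2
  exact (h3.comp t h1).contDiffAt

omit [IsManifold (𝓡 2) ∞ M] in
lemma coordCurve_mem_target {γ : ℝ → M} {t : ℝ} (h : γ t ∈ (chartAt Plane (γ 0)).source) :
    coordCurve γ t ∈ (extChartAt (𝓡 2) (γ 0)).target :=
  (extChartAt (𝓡 2) (γ 0)).map_source (by simpa using h)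

lemma toCoord_velocity {γ : ℝ → M} {t : ℝ} (h : γ t ∈ (chartAt Plane (γ 0)).source)
    (hγ : ContMDiffAt 𝓘(ℝ, ℝ) (𝓡 2) ∞ γ t) :
    toCoord (γ 0) (γ t) (velocity γ t) = deriv (coordCurve γ) t :=
  (hasDerivAt_extChartAt_comp h (hγ.mdifferentiableAt (by simp))).deriv.symm

section Riemannian

variable [RiemannianBundle (fun x : M => TangentSpace (𝓡 2) x)]

lemma christoffelVec_smul_smul (c : M) (y : Plane) (a b : ℝ) (u v : Plane) :
    christoffelVec c y (a • u) (b • v) = (a * b) • christoffelVec c y u v := by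
  ext k
  simp [christoffelVec, Fin.sum_univ_two]
  ring

lemma metricQuad_smul (c : M) (y : Plane) (a : ℝ) (u : Plane) :
    metricQuad c y (a • u) = a ^ 2 * metricQuad c y u := by
  simp [metricQuad, Fin.sum_univ_two]
  ring

lemma sqrt_metricQuad_smul (c : M) (y : Plane) (a : ℝ) (u : Plane) :
    √(metricQuad c y (a • u)) = |a| * √(metricQuad c y u) := by
  rw [metricQuad_smul, Real.sqrt_mul (sq_nonneg a), Real.sqrt_sq_eq_abs]

lemma toCoord_covDerivAlong {c : M} {γ : ℝ → M} {X : ∀ t, TangentSpace (𝓡 2) (γ t)} {t : ℝ}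
    {W : ℝ → Plane} {W' : Plane} (hx : γ t ∈ (chartAt Plane c).source)
    (hX : ∀ᶠ r in 𝓝 t, toCoord c (γ r) (X r) = W r) (hW : HasDerivAt W W' t) :
    toCoord c (γ t) (covDerivAlong c γ X t) =
      W' + christoffelVec c (extChartAt (𝓡 2) c (γ t)) (toCoord c (γ t) (velocity γ t)) (W t) := by
  rw [covDerivAlong, toCoord_ofCoord hx]
  ext k
  have hd : HasDerivAt (fun r => W r k) (W' k) t :=
    (EuclideanSpace.proj (𝕜 := ℝ) (ι := Fin 2) k).hasFDerivAt.comp_hasDerivAt t hW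
  have he : (fun r => toCoord c (γ r) (X r) k) =ᶠ[𝓝 t] fun r => W r k :=
    hX.mono fun r hr => by simp only [hr]
  simp only [christoffelVec, PiLp.add_apply]
  rw [he.deriv_eq, hd.deriv, hX.self_of_nhds]

/-- The coordinates of the covariant acceleration, divided by the parameter, up to the leading
term: if the velocity is `t • u t`, then the acceleration is `u t + t • accelTail c y u t`. -/
def accelTail (c : M) (y u : ℝ → Plane) (t : ℝ) : Plane :=
  deriv u t + t • christoffelVec c (y t) (u t) (u t)

omit [RiemannianBundle (fun x : M => TangentSpace (𝓡 2) x)] in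
lemma eventually_toCoord_velocity_eq {γ : ℝ → M} {u : ℝ → Plane}
    (hγ : ∀ᶠ t in 𝓝 (0 : ℝ), ContMDiffAt 𝓘(ℝ, ℝ) (𝓡 2) ∞ γ t)
    (hy : ∀ᶠ t in 𝓝 (0 : ℝ), deriv (coordCurve γ) t = t • u t) :
    ∀ᶠ t in 𝓝 (0 : ℝ), toCoord (γ 0) (γ t) (velocity γ t) = t • u t := by
  filter_upwards [hγ, eventually_mem_chart_source hγ, hy] with t h1 h2 h3
  rw [toCoord_velocity h2 h1, h3]

/-- Differentiating `t • u` gives `u + t • u'`, and the Christoffel term, bilinear in two copies of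
`t • u`, contributes a factor `t ^ 2`. -/
lemma eventually_toCoord_accel_eq {γ : ℝ → M} {u : ℝ → Plane}
    (hγ : ∀ᶠ t in 𝓝 (0 : ℝ), ContMDiffAt 𝓘(ℝ, ℝ) (𝓡 2) ∞ γ t) (hu : SmoothNearZero u)
    (hy : ∀ᶠ t in 𝓝 (0 : ℝ), deriv (coordCurve γ) t = t • u t) :
    ∀ᶠ t in 𝓝 (0 : ℝ), toCoord (γ 0) (γ t) (accel γ t) =
      u t + t • accelTail (γ 0) (coordCurve γ) u t := by
  have hv := eventually_toCoord_velocity_eq hγ hy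
  filter_upwards [eventually_mem_chart_source hγ, hv.eventually_nhds, hu] with t h1 h2 h3
  have hd : HasDerivAt (fun r => r • u r) (t • deriv u t + (1 : ℝ) • u t) t :=
    (hasDerivAt_id t).smul (h3.differentiableAt (by simp)).hasDerivAt
  rw [accel, toCoord_covDerivAlong h1 h2 hd, h2.self_of_nhds, christoffelVec_smul_smul]
  simp only [accelTail, coordCurve, one_smul, smul_add, smul_smul]
  abel

variable [IsContMDiffRiemannianBundle (𝓡 2) ∞ Plane (fun x : M => TangentSpace (𝓡 2) x)]

section ContDiff

variable {F : Type*} [NormedAddCommGroup F] [NormedSpace ℝ F] {c : M} {y u v : F → Plane} {p : F}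

lemma contDiffAt_christoffelVec (hy : ContDiffAt ℝ ∞ y p)
    (hyt : y p ∈ (extChartAt (𝓡 2) c).target) (hu : ContDiffAt ℝ ∞ u p)
    (hv : ContDiffAt ℝ ∞ v p) :
    ContDiffAt ℝ ∞ (fun q => christoffelVec c (y q) (u q) (v q)) p := by
  rw [contDiffAt_piLp 2]
  intro k
  simp only [christoffelVec]
  exact ContDiffAt.sum fun i _ => ContDiffAt.sum fun j _ =>
    (((contDiffAt_christoffel hyt k i j).comp p hy).mul (contDiffAt_apply hu i)).mul
      (contDiffAt_apply hv j)

lemma contDiffAt_metricQuad (hy : ContDiffAt ℝ ∞ y p)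
    (hyt : y p ∈ (extChartAt (𝓡 2) c).target) (hu : ContDiffAt ℝ ∞ u p) :
    ContDiffAt ℝ ∞ (fun q => metricQuad c (y q) (u q)) p :=
  ContDiffAt.sum fun i _ => ContDiffAt.sum fun j _ =>
    (((contDiffAt_metricMatrix hyt i j).comp p hy).mul (contDiffAt_apply hu i)).mul
      (contDiffAt_apply hu j)

lemma contDiffAt_sqrt_metricQuad (hy : ContDiffAt ℝ ∞ y p)
    (hyt : y p ∈ (extChartAt (𝓡 2) c).target) (hu : ContDiffAt ℝ ∞ u p) (hu0 : u p ≠ 0) :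
    ContDiffAt ℝ ∞ (fun q => √(metricQuad c (y q) (u q))) p :=
  (contDiffAt_metricQuad hy hyt hu).sqrt (metricQuad_pos hyt hu0).ne'

lemma contDiffAt_sqrt_det (hy : ContDiffAt ℝ ∞ y p)
    (hyt : y p ∈ (extChartAt (𝓡 2) c).target) :
    ContDiffAt ℝ ∞ (fun q => √(metricMatrix c (y q)).det) p := by
  refine ContDiffAt.sqrt ?_ (metricMatrix_det_pos hyt).ne'
  have h : ∀ i j, ContDiffAt ℝ ∞ (fun q => metricMatrix c (y q) i j) p := fun i j =>
    (contDiffAt_metricMatrix hyt i j).comp p hy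
  simp only [Matrix.det_fin_two]
  exact ((h _ _).mul (h _ _)).sub ((h _ _).mul (h _ _))

end ContDiff

lemma smoothNearZero_accelTail {γ : ℝ → M} {u : ℝ → Plane}
    (hγ : ∀ᶠ t in 𝓝 (0 : ℝ), ContMDiffAt 𝓘(ℝ, ℝ) (𝓡 2) ∞ γ t) (hu : SmoothNearZero u) :
    SmoothNearZero (accelTail (γ 0) (coordCurve γ) u) := by
  filter_upwards [smoothNearZero_coordCurve hγ, eventually_mem_chart_source hγ, hu, hu.deriv]
    with t h1 h2 h3 h4
  exact h4.add (contDiffAt_id.smul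
    (contDiffAt_christoffelVec h1 (coordCurve_mem_target h2) h3 h3))

/-- At `0` the velocity vanishes and with it the Christoffel term; `deriv u 0` occurs twice, once
from `u` and once as the value of the tail at `0`. -/
lemma toCoord_jerk_zero {γ : ℝ → M} {u : ℝ → Plane}
    (hγ : ∀ᶠ t in 𝓝 (0 : ℝ), ContMDiffAt 𝓘(ℝ, ℝ) (𝓡 2) ∞ γ t) (hu : SmoothNearZero u)
    (hy : ∀ᶠ t in 𝓝 (0 : ℝ), deriv (coordCurve γ) t = t • u t) :
    toCoord (γ 0) (γ 0) (jerk γ 0) = (2 : ℝ) • deriv u 0 := by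
  have hd : HasDerivAt (fun t => u t + t • accelTail (γ 0) (coordCurve γ) u t)
      (deriv u 0 + ((0 : ℝ) • deriv (accelTail (γ 0) (coordCurve γ) u) 0 +
        (1 : ℝ) • accelTail (γ 0) (coordCurve γ) u 0)) 0 :=
    (hu.contDiffAt.differentiableAt (by simp)).hasDerivAt.add ((hasDerivAt_id (0 : ℝ)).smul
      ((smoothNearZero_accelTail hγ hu).contDiffAt.differentiableAt (by simp)).hasDerivAt)
  rw [jerk, toCoord_covDerivAlong (mem_chart_source Plane (γ 0))
    (eventually_toCoord_accel_eq hγ hu hy) hd,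
    (eventually_toCoord_velocity_eq hγ hy).self_of_nhds]
  have h0 : ∀ v, christoffelVec (γ 0) (extChartAt (𝓡 2) (γ 0) (γ 0)) ((0 : ℝ) • u 0) v = 0 := by
    intro v
    have := christoffelVec_smul_smul (γ 0) (extChartAt (𝓡 2) (γ 0) (γ 0)) 0 1 (u 0) v
    simpa using this
  rw [h0, two_smul]
  simp [accelTail]

/-- The cusp condition in coordinates. -/
lemma bracket_accel_jerk_eq {o : ManifoldOrientation M} {γ : ℝ → M} {u : ℝ → Plane} {ε : ℝ}
    (hγ : ∀ᶠ t in 𝓝 (0 : ℝ), ContMDiffAt 𝓘(ℝ, ℝ) (𝓡 2) ∞ γ t) (hu : SmoothNearZero u)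
    (hy : ∀ᶠ t in 𝓝 (0 : ℝ), deriv (coordCurve γ) t = t • u t)
    (hε : ∀ᶠ x in 𝓝 (γ 0), ∀ v w : TangentSpace (𝓡 2) x,
      bracket o x v w = ε * √(metricMatrix (γ 0) (extChartAt (𝓡 2) (γ 0) x)).det *
        cross (toCoord (γ 0) x v) (toCoord (γ 0) x w)) :
    bracket o (γ 0) (accel γ 0) (jerk γ 0) =
      2 * (ε * √(metricMatrix (γ 0) (coordCurve γ 0)).det * cross (u 0) (deriv u 0)) := by
  rw [hε.self_of_nhds, toCoord_jerk_zero hγ hu hy,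
    (eventually_toCoord_accel_eq hγ hu hy).self_of_nhds, zero_smul, add_zero, cross_smul_right,
    coordCurve]
  ring

omit [IsContMDiffRiemannianBundle (𝓡 2) ∞ Plane (fun x : M => TangentSpace (𝓡 2) x)] in
/-- The normalized curvature function in coordinates, away from the singular point. -/
lemma rawNormalizedCurvature_eventuallyEq {o : ManifoldOrientation M} {γ : ℝ → M}
    {u : ℝ → Plane} {n : ℝ → ℝ} {ε : ℝ}
    (hγ : ∀ᶠ t in 𝓝 (0 : ℝ), ContMDiffAt 𝓘(ℝ, ℝ) (𝓡 2) ∞ γ t) (hu : SmoothNearZero u)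
    (hy : ∀ᶠ t in 𝓝 (0 : ℝ), deriv (coordCurve γ) t = t • u t)
    (hε : ∀ᶠ x in 𝓝 (γ 0), ∀ v w : TangentSpace (𝓡 2) x,
      bracket o x v w = ε * √(metricMatrix (γ 0) (extChartAt (𝓡 2) (γ 0) x)).det *
        cross (toCoord (γ 0) x v) (toCoord (γ 0) x w))
    (hn : ∀ᶠ t in 𝓝 (0 : ℝ), √(metricQuad (γ 0) (coordCurve γ t) (u t)) = n t)
    (hn0 : ∀ᶠ t in 𝓝 (0 : ℝ), 0 < n t) :
    rawNormalizedCurvature o γ =ᶠ[𝓝[≠] 0] fun t =>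
      √|∫ s in (0 : ℝ)..1, s ^ 1 • n (t * s)| *
        (ε * √(metricMatrix (γ 0) (coordCurve γ t)).det *
          cross (u t) (accelTail (γ 0) (coordCurve γ) u t)) / n t ^ 3 := by
  have hv := eventually_toCoord_velocity_eq hγ hy
  have hnorm : ∀ᶠ t in 𝓝 (0 : ℝ), ‖velocity γ t‖ = |t| * n t := by
    filter_upwards [hv, eventually_mem_chart_source hγ, hn] with t h1 h2 h3
    rw [norm_eq_sqrt_metricQuad h2, h1, sqrt_metricQuad_smul, ← h3, coordCurve]
  have harc : ∀ᶠ t in 𝓝 (0 : ℝ),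
      arclength γ t = |t| * t * ∫ s in (0 : ℝ)..1, s ^ 1 • n (t * s) := by
    obtain ⟨r, hr, hball⟩ := Metric.eventually_nhds_iff_ball.1 hnorm
    filter_upwards [Metric.ball_mem_nhds (0 : ℝ) hr] with t ht
    rw [← integral_abs_mul_eq]
    refine intervalIntegral.integral_congr fun x hx => hball x ?_
    exact (convex_ball (0 : ℝ) r).ordConnected.uIcc_subset (Metric.mem_ball_self hr) ht hx
  have hbr := hγ.self_of_nhds.continuousAt.eventually hε
  filter_upwards [nhdsWithin_le_nhds hnorm, nhdsWithin_le_nhds harc, nhdsWithin_le_nhds hbr,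
    nhdsWithin_le_nhds hv, nhdsWithin_le_nhds (eventually_toCoord_accel_eq hγ hu hy),
    nhdsWithin_le_nhds hn0, self_mem_nhdsWithin] with t h1 h2 h3 h4 h5 h6 h7
  have ht : 0 < |t| := abs_pos.2 h7
  -- The bracket of `t • u` with `u + t • A` loses its `[u, u]` term, so it has order `t ^ 2`; with
  -- the factor `|t|` from `√|s|` this matches the `|t| ^ 3` of the speed cubed.
  have hb : bracket o (γ t) (velocity γ t) (accel γ t) = |t| ^ 2 *
      (ε * √(metricMatrix (γ 0) (coordCurve γ t)).det *
        cross (u t) (accelTail (γ 0) (coordCurve γ) u t)) := by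
    rw [h3, h4, h5, cross_smul_left, cross_add_right, cross_self, cross_smul_right, sq_abs,
      coordCurve]
    ring
  have hs : √|arclength γ t| = |t| * √|∫ s in (0 : ℝ)..1, s ^ 1 • n (t * s)| := by
    rw [h2, abs_mul, abs_mul, abs_abs, Real.sqrt_mul (by positivity),
      Real.sqrt_mul_self (abs_nonneg t)]
  rw [rawNormalizedCurvature, geodesicCurvature, hb, hs, h1]
  generalize √|∫ s in (0 : ℝ)..1, s ^ 1 • n (t * s)| = I
  field_simp

omit [IsContMDiffRiemannianBundle (𝓡 2) ∞ Plane (fun x : M => TangentSpace (𝓡 2) x)] in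
-- Continuity of `f` makes `f 0` the limit that `limUnder` selects, so agreement off `0` extends
-- across `0`.
lemma normalizedCurvature_eventuallyEq {o : ManifoldOrientation M} {γ : ℝ → M} {f : ℝ → ℝ}
    (h : rawNormalizedCurvature o γ =ᶠ[𝓝[≠] 0] f) (hf : ContinuousAt f 0) :
    normalizedCurvature o γ =ᶠ[𝓝 0] f := by
  have hlim : limUnder (𝓝[≠] (0 : ℝ)) (rawNormalizedCurvature o γ) = f 0 :=
    ((hf.tendsto.mono_left nhdsWithin_le_nhds).congr' h.symm).limUnder_eq
  rw [EventuallyEq, eventually_nhdsWithin_iff] at h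
  filter_upwards [h] with t ht
  rw [normalizedCurvature, hlim]
  by_cases h0 : t = 0
  · simp [h0]
  · rw [Function.update_of_ne h0, ht h0]

end Riemannian

end

end CuspCurvature

namespace CuspCurvature

noncomputable section

variable {M : Type*} [TopologicalSpace M] [ChartedSpace Plane M] [IsManifold (𝓡 2) ∞ M]
  [RiemannianBundle (fun x : M => TangentSpace (𝓡 2) x)]

/-! ### Smoothness of the normalized curvature, and realization of a given one. -/

lemma IsCusp.eventually_contMDiffAt {o : ManifoldOrientation M} {γ : ℝ → M} (h : IsCusp o γ) :
    ∀ᶠ t in 𝓝 (0 : ℝ), ContMDiffAt 𝓘(ℝ, ℝ) (𝓡 2) ∞ γ t := by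
  obtain ⟨δ, hδ, hs⟩ := h.smooth
  filter_upwards [Ioo_mem_nhds (neg_lt_zero.2 hδ) hδ] with t ht
  exact hs.contMDiffAt (Ioo_mem_nhds ht.1 ht.2)

variable [IsContMDiffRiemannianBundle (𝓡 2) ∞ Plane (fun x : M => TangentSpace (𝓡 2) x)]

/-- The normalized curvature function of a 3/2-cusp is smooth and does not vanish at `0`. -/
theorem IsCusp.exists_smooth_normalizedCurvature {o : ManifoldOrientation M} {γ : ℝ → M}
    (h : IsCusp o γ) :
    ∃ f : ℝ → ℝ, SmoothNearZero f ∧ f 0 ≠ 0 ∧ normalizedCurvature o γ =ᶠ[𝓝 0] f := by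
  have hγ := h.eventually_contMDiffAt
  have hys := smoothNearZero_coordCurve hγ
  have hy0 : deriv (coordCurve γ) 0 = 0 := by
    rw [← toCoord_velocity (mem_chart_source Plane (γ 0)) hγ.self_of_nhds, h.singular]
    exact map_zero _
  obtain ⟨u, hu, hy⟩ := hys.deriv.exists_eq_smul hy0
  obtain ⟨ε, -, hε⟩ := exists_sign_bracket_eq o (γ 0)
  have hb := h.bracket_ne_zero
  rw [bracket_accel_jerk_eq hγ hu hy hε] at hb
  have hu0 : u 0 ≠ 0 := fun h0 => hb (by simp [h0, cross])
  have hune : ∀ᶠ t in 𝓝 (0 : ℝ), u t ≠ 0 := hu.contDiffAt.continuousAt.eventually_ne hu0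
  have htarget : ∀ᶠ t in 𝓝 (0 : ℝ), coordCurve γ t ∈ (extChartAt (𝓡 2) (γ 0)).target :=
    (eventually_mem_chart_source hγ).mono fun _ => coordCurve_mem_target
  let n : ℝ → ℝ := fun t => √(metricQuad (γ 0) (coordCurve γ t) (u t))
  have hn0 : ∀ᶠ t in 𝓝 (0 : ℝ), 0 < n t := by
    filter_upwards [hune, htarget] with t h1 h2
    exact Real.sqrt_pos.2 (metricQuad_pos h2 h1)
  have hns : SmoothNearZero n := by
    filter_upwards [hys, htarget, hu, hune] with t h1 h2 h3 h4
    exact contDiffAt_sqrt_metricQuad h1 h2 h3 h4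
  have hI := hns.integral_pow_smul_comp_mul 1
  -- The integral is `n 0 / 2`.
  have hI0 : (∫ s in (0 : ℝ)..1, s ^ 1 • n (0 * s)) ≠ 0 := by
    have := hn0.self_of_nhds.ne'
    simpa using this
  have hraw := rawNormalizedCurvature_eventuallyEq hγ hu hy hε (.of_forall fun _ => rfl) hn0
  have hsmooth : SmoothNearZero fun t => √|∫ s in (0 : ℝ)..1, s ^ 1 • n (t * s)| *
      (ε * √(metricMatrix (γ 0) (coordCurve γ t)).det *
        cross (u t) (accelTail (γ 0) (coordCurve γ) u t)) / n t ^ 3 := by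
    filter_upwards [hI, hI.contDiffAt.continuousAt.eventually_ne hI0, hys, htarget, hu,
      smoothNearZero_accelTail hγ hu, hns, hn0] with t h1 h2 h3 h4 h5 h6 h7 h8
    exact ((h1.abs h2).sqrt (abs_ne_zero.2 h2)).mul ((contDiffAt_const.mul
      (contDiffAt_sqrt_det h3 h4)).mul (contDiffAt_cross h5 h6)) |>.div (h7.pow 3) (by positivity)
  refine ⟨_, hsmooth, ?_, normalizedCurvature_eventuallyEq hraw hsmooth.contDiffAt.continuousAt⟩
  -- At `0` the remaining determinant is the one in the cusp condition.
  have hc : accelTail (γ 0) (coordCurve γ) u 0 = deriv u 0 := by simp [accelTail]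
  rw [hc]
  exact div_ne_zero (mul_ne_zero (Real.sqrt_ne_zero'.2 (abs_pos.2 hI0)) (right_ne_zero_of_mul hb))
    (pow_ne_zero 3 hn0.self_of_nhds.ne')

/-- The vector `(1, p)` of the coordinate plane. -/
def slopeVec (p : ℝ) : Plane := basisVec 0 + p • basisVec 1

omit [RiemannianBundle (fun x : M => TangentSpace (𝓡 2) x)]
  [IsContMDiffRiemannianBundle (𝓡 2) ∞ Plane (fun x : M => TangentSpace (𝓡 2) x)] in
lemma slopeVec_ne_zero (p : ℝ) : slopeVec p ≠ 0 := fun h => by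
  simpa [slopeVec, basisVec] using congrArg (fun v : Plane => v 0) h

/-- The unit vector at `y` with the direction `(1, p)`. -/
def unitVec (c : M) (y : Plane) (p : ℝ) : Plane :=
  (√(metricQuad c y (slopeVec p)))⁻¹ • slopeVec p

lemma contDiffAt_unitVec {F : Type*} [NormedAddCommGroup F] [NormedSpace ℝ F] {c : M}
    {y : F → Plane} {p : F → ℝ} {q : F} (hy : ContDiffAt ℝ ∞ y q)
    (hyt : y q ∈ (extChartAt (𝓡 2) c).target) (hp : ContDiffAt ℝ ∞ p q) :
    ContDiffAt ℝ ∞ (fun z => unitVec c (y z) (p z)) q := by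
  have hs : ContDiffAt ℝ ∞ (fun z => slopeVec (p z)) q :=
    contDiffAt_const.add (hp.smul contDiffAt_const)
  exact ((contDiffAt_sqrt_metricQuad hy hyt hs (slopeVec_ne_zero _)).inv
    (Real.sqrt_ne_zero'.2 (metricQuad_pos hyt (slopeVec_ne_zero _)))).smul hs

/-- In coordinates, a smooth curve with velocity `t • u t`, where `u` is a unit vector field with
prescribed determinant against the tail of the acceleration. -/
lemma exists_coord_curve (c : M) {f : ℝ → ℝ} (hf : SmoothNearZero f) :
    ∃ y u : ℝ → Plane, y 0 = extChartAt (𝓡 2) c c ∧ SmoothNearZero y ∧ SmoothNearZero u ∧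
      (∀ᶠ t in 𝓝 (0 : ℝ), deriv y t = t • u t) ∧
      (∀ᶠ t in 𝓝 (0 : ℝ), √(metricQuad c (y t) (u t)) = 1) ∧
      ∀ᶠ t in 𝓝 (0 : ℝ), √(metricMatrix c (y t)).det * cross (u t) (accelTail c y u t) = f t := by
  -- Unknowns are the position and the slope `p`. For the unit vector `u` along `(1, p)`, `cross u
  -- u' = p' / |(1, p)|²`; the second component is the prescribed equation solved for `p'`.
  let G : ℝ × (Plane × ℝ) → Plane × ℝ := fun q =>
    (q.1 • unitVec c q.2.1 q.2.2,
      √(metricQuad c q.2.1 (slopeVec q.2.2)) ^ 2 * (f q.1 / √(metricMatrix c q.2.1).det -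
        q.1 * cross (unitVec c q.2.1 q.2.2)
          (christoffelVec c q.2.1 (unitVec c q.2.1 q.2.2) (unitVec c q.2.1 q.2.2))))
  have htgt : ∀ᶠ z in 𝓝 (extChartAt (𝓡 2) c c), z ∈ (extChartAt (𝓡 2) c).target :=
    (isOpen_extChartAt_target c).mem_nhds (mem_extChartAt_target c)
  have hG : ∀ᶠ q in 𝓝 ((0 : ℝ), (extChartAt (𝓡 2) c c, (0 : ℝ))), ContDiffAt ℝ ∞ G q := by
    have h1 : ∀ᶠ q : ℝ × (Plane × ℝ) in 𝓝 ((0 : ℝ), (extChartAt (𝓡 2) c c, (0 : ℝ))),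
        q.2.1 ∈ (extChartAt (𝓡 2) c).target :=
      (continuous_fst.comp continuous_snd).continuousAt.eventually htgt
    have h2 : ∀ᶠ q : ℝ × (Plane × ℝ) in 𝓝 ((0 : ℝ), (extChartAt (𝓡 2) c c, (0 : ℝ))),
        ContDiffAt ℝ ∞ f q.1 := continuous_fst.continuousAt.eventually hf
    filter_upwards [h1, h2] with q hq hfq
    have hy : ContDiffAt ℝ ∞ (fun q : ℝ × (Plane × ℝ) => q.2.1) q := contDiffAt_snd.fst
    have hp : ContDiffAt ℝ ∞ (fun q : ℝ × (Plane × ℝ) => q.2.2) q := contDiffAt_snd.snd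
    have ht : ContDiffAt ℝ ∞ (fun q : ℝ × (Plane × ℝ) => q.1) q := contDiffAt_fst
    have hs : ContDiffAt ℝ ∞ (fun q : ℝ × (Plane × ℝ) => slopeVec q.2.2) q :=
      contDiffAt_const.add (hp.smul contDiffAt_const)
    have hU := contDiffAt_unitVec hy hq hp
    exact (ht.smul hU).prodMk (((contDiffAt_sqrt_metricQuad hy hq hs (slopeVec_ne_zero _)).pow
      2).mul (((hfq.comp q ht).div (contDiffAt_sqrt_det hy hq)
        (Real.sqrt_ne_zero'.2 (metricMatrix_det_pos hq))).sub
          (ht.mul (contDiffAt_cross hU (contDiffAt_christoffelVec hy hq hU hU)))))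
  obtain ⟨α, hα0, hαs, hα⟩ := exists_smooth_solution hG
  have hyd : ∀ᶠ t in 𝓝 (0 : ℝ), HasDerivAt (fun t => (α t).1)
      (t • unitVec c (α t).1 (α t).2) t :=
    hα.mono fun t h => (hasFDerivAt_fst (𝕜 := ℝ) (p := α t)).comp_hasDerivAt t h
  have hpd : ∀ᶠ t in 𝓝 (0 : ℝ), HasDerivAt (fun t => (α t).2) (G (t, α t)).2 t :=
    hα.mono fun t h => (hasFDerivAt_snd (𝕜 := ℝ) (p := α t)).comp_hasDerivAt t h
  have hyt : ∀ᶠ t in 𝓝 (0 : ℝ), (α t).1 ∈ (extChartAt (𝓡 2) c).target := by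
    refine (continuous_fst.continuousAt.comp hαs.contDiffAt.continuousAt).eventually ?_
    simpa [hα0] using htgt
  refine ⟨fun t => (α t).1, fun t => unitVec c (α t).1 (α t).2, by simp [hα0],
    hαs.mono fun t h => h.fst, ?_, hyd.mono fun t h => h.deriv, ?_, ?_⟩
  · filter_upwards [hαs, hyt] with t h1 h2
    exact contDiffAt_unitVec h1.fst h2 h1.snd
  · filter_upwards [hyt] with t h
    have hpos := Real.sqrt_pos.2 (metricQuad_pos h (slopeVec_ne_zero (α t).2))
    rw [unitVec, sqrt_metricQuad_smul, abs_of_pos (inv_pos.2 hpos), inv_mul_cancel₀ hpos.ne']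
  · filter_upwards [hyt, hpd, hαs] with t h1 h2 h3
    have hpos := Real.sqrt_pos.2 (metricQuad_pos h1 (slopeVec_ne_zero (α t).2))
    have hdet := Real.sqrt_pos.2 (metricMatrix_det_pos h1)
    have hs : HasDerivAt (fun t => slopeVec (α t).2) ((G (t, α t)).2 • basisVec 1) t :=
      (h2.smul_const (basisVec 1)).const_add _
    have hsm : ContDiffAt ℝ ∞ (fun t => slopeVec (α t).2) t :=
      contDiffAt_const.add (h3.snd.smul contDiffAt_const)
    have hk := (((contDiffAt_sqrt_metricQuad h3.fst h1 hsm (slopeVec_ne_zero _)).inv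
      hpos.ne').differentiableAt (by simp)).hasDerivAt
    have hd := (hk.smul hs).deriv
    have hcr : ∀ p, cross (slopeVec p) (basisVec 1) = 1 := fun p => by
      simp [cross, slopeVec, basisVec]
    -- Differentiating the normalizing factor gives a multiple of `u` itself, which the determinant
    -- kills.
    have hcross : cross (unitVec c (α t).1 (α t).2)
        (deriv (fun t => unitVec c (α t).1 (α t).2) t) =
          (√(metricQuad c (α t).1 (slopeVec (α t).2)))⁻¹ ^ 2 * (G (t, α t)).2 := by
      refine (congrArg (cross _) hd).trans ?_
      rw [unitVec, cross_add_right, cross_smul_left, cross_smul_left, cross_smul_right,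
        cross_smul_right, cross_smul_right, hcr, cross_self, Pi.inv_apply]
      ring
    rw [accelTail, cross_add_right, hcross, cross_smul_right]
    simp only [G]
    field_simp
    ring

/-- Every smooth function which does not vanish at `0` is, near `0`, the normalized curvature
function of a 3/2-cusp. -/
theorem exists_isCusp_normalizedCurvature_eq (o : ManifoldOrientation M) (c : M) {f : ℝ → ℝ}
    (hf : SmoothNearZero f) (hf0 : f 0 ≠ 0) :
    ∃ γ : ℝ → M, IsCusp o γ ∧ normalizedCurvature o γ =ᶠ[𝓝 0] f := by
  obtain ⟨ε, hε1, hε⟩ := exists_sign_bracket_eq o c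
  -- For unit `u` the arclength integral is `1/2`, so `√2` compensates `√(1/2)`; the factor `ε`
  -- cancels the orientation sign, as `ε ^ 2 = 1`.
  obtain ⟨y, u, hy0, hys, hu, hyd, hn, hcr⟩ := exists_coord_curve c
    (f := fun t => √2 * ε * f t) (hf.mono fun t h => contDiffAt_const.mul h)
  have hyt : ∀ᶠ t in 𝓝 (0 : ℝ), y t ∈ (extChartAt (𝓡 2) c).target :=
    hys.contDiffAt.continuousAt.eventually
      ((isOpen_extChartAt_target c).mem_nhds (hy0 ▸ mem_extChartAt_target c))
  obtain ⟨γ, hγdef⟩ : ∃ γ : ℝ → M, γ = fun t => (extChartAt (𝓡 2) c).symm (y t) := ⟨_, rfl⟩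
  have hγ0 : γ 0 = c := by
    simp only [hγdef, hy0]
    exact extChartAt_to_inv c
  have hγ : ∀ᶠ t in 𝓝 (0 : ℝ), ContMDiffAt 𝓘(ℝ, ℝ) (𝓡 2) ∞ γ t := by
    filter_upwards [hys, hyt] with t h1 h2
    have hs : ContMDiffAt 𝓘(ℝ, Plane) (𝓡 2) ∞ (extChartAt (𝓡 2) c).symm (y t) :=
      (contMDiffOn_extChartAt_symm c).contMDiffAt ((isOpen_extChartAt_target c).mem_nhds h2)
    rw [hγdef]
    exact hs.comp t h1.contMDiffAt
  have hcoord : coordCurve γ =ᶠ[𝓝 0] y := by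
    filter_upwards [hyt] with t h
    rw [coordCurve, hγ0, hγdef]
    exact (extChartAt (𝓡 2) c).right_inv h
  -- Once `γ` is opaque, `c` can be replaced by `γ 0`, whose chart defines the acceleration and the
  -- jerk.
  clear hγdef
  subst hγ0
  have hyd' : ∀ᶠ t in 𝓝 (0 : ℝ), deriv (coordCurve γ) t = t • u t := by
    filter_upwards [hyd, hcoord.eventuallyEq_nhds] with t h1 h2
    rw [h2.deriv_eq, h1]
  have hn' : ∀ᶠ t in 𝓝 (0 : ℝ), √(metricQuad (γ 0) (coordCurve γ t) (u t)) = 1 := by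
    filter_upwards [hn, hcoord] with t h1 h2
    rw [h2, h1]
  have hcr' : ∀ᶠ t in 𝓝 (0 : ℝ), √(metricMatrix (γ 0) (coordCurve γ t)).det *
      cross (u t) (accelTail (γ 0) (coordCurve γ) u t) = √2 * ε * f t := by
    filter_upwards [hcr, hcoord] with t h1 h2
    rw [accelTail, h2]
    exact h1
  have hε0 : ε ≠ 0 := fun h => by simp [h] at hε1
  refine ⟨γ, ⟨?_, ?_, ?_⟩, ?_⟩
  · obtain ⟨δ, hδ, h⟩ := exists_symm_Ioo_of_eventually hγ
    exact ⟨δ, hδ, fun t ht => (h t ht).contMDiffWithinAt⟩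
  · have h := (eventually_toCoord_velocity_eq hγ hyd').self_of_nhds
    rw [zero_smul] at h
    rw [← ofCoord_toCoord (mem_chart_source Plane (γ 0)) (velocity γ 0), h]
    exact map_zero _
  · rw [bracket_accel_jerk_eq hγ hu hyd' hε]
    have h := hcr'.self_of_nhds
    rw [accelTail, zero_smul, add_zero] at h
    rw [mul_assoc ε, h]
    have : √(2 : ℝ) ≠ 0 := by positivity
    simp [hε0, hf0]
  · refine normalizedCurvature_eventuallyEq ?_ hf.contDiffAt.continuousAt
    refine (rawNormalizedCurvature_eventuallyEq hγ hu hyd' hε hn'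
      (.of_forall fun _ => one_pos)).trans ?_
    filter_upwards [nhdsWithin_le_nhds hcr'] with t h
    rw [mul_assoc ε, h]
    have hI : ∫ s in (0 : ℝ)..1, s ^ 1 • (1 : ℝ) = 1 / 2 := by simp
    have h2 : √|(1 / 2 : ℝ)| * √2 = 1 := by
      rw [← Real.sqrt_mul (abs_nonneg _), abs_of_pos (by norm_num)]
      norm_num
    rw [hI]
    linear_combination (f t * ε ^ 2) * h2 + f t * hε1

end

end CuspCurvature

/-! ### Passage to germs. -/

theorem corollary2p8 {M : Type*} [TopologicalSpace M] [ChartedSpace CuspCurvature.Plane M]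
    [IsManifold (𝓡 2) ∞ M] [Nonempty M]
    [RiemannianBundle (fun x : M => TangentSpace (𝓡 2) x)]
    [IsContMDiffRiemannianBundle (𝓡 2) ∞ CuspCurvature.Plane
      (fun x : M => TangentSpace (𝓡 2) x)]
    (o : CuspCurvature.ManifoldOrientation M) :
    Set.range (CuspCurvature.normalizedCurvatureMap o) =
      {f : Germ (𝓝 (0 : ℝ)) ℝ | CuspCurvature.IsSmoothGerm f ∧ f.value ≠ 0} := by
  ext f
  constructor
  · rintro ⟨⟨_, γ, rfl, hγ⟩, rfl⟩
    obtain ⟨F, hF, hF0, h⟩ := hγ.exists_smooth_normalizedCurvature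
    have he : CuspCurvature.normalizedCurvatureMap o ⟨(γ : Germ (𝓝 (0 : ℝ)) M), γ, rfl, hγ⟩ =
        (F : Germ (𝓝 (0 : ℝ)) ℝ) := Germ.coe_eq.2 h
    rw [he]
    exact ⟨⟨F, rfl, hF.exists_contDiffOn⟩, hF0⟩
  · rintro ⟨⟨F, rfl, δ, hδ, hF⟩, hF0⟩
    -- Every point of `M` carries a cusp with the given curvature function, so any base point
    -- serves.
    obtain ⟨γ, hγ, h⟩ := CuspCurvature.exists_isCusp_normalizedCurvature_eq o
      (Classical.arbitrary M) (CuspCurvature.smoothNearZero_of_contDiffOn hδ hF) hF0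
    exact ⟨⟨(γ : Germ (𝓝 (0 : ℝ)) M), γ, rfl, hγ⟩, Germ.coe_eq.2 h⟩
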